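/- Let $F$ be a field of characteristic different from $2$, and let all algebraic extensions of $F$ be taken inside a fixed algebraic closure of $F$. Let $F_q$ be the quadratic closure of $F$, i.e. the smallest extension of $F$ that contains the square roots of all its elements. For any field $K$ with $F\subset K\subset F_q$ define $K=K^{(1)}\subset K^{(2)}\subset K^{(3)}\subset\cdots$ by letting $K^{(n+1)}$ be the compositum over $K^{(n)}$ of all quadratic extensions of $K^{(n)}$ which are Galois over $K$ (so $K^{(n+1)}=K^{(n)}$ if there are none). Let $(\sqrt{}/F)^{(3)}$ be the compositum over $F$ of the fields $L^{(3)}$, where $L$ runs over all quadratic extensions of $F$ (so it is $F$ if there are none). Call $F$ quadratically closed if $F_q=F$, and Euclidean if the set $F^{*2}$ of squares of nonzero elements is (the set of positive elements of) an ordering of $F$; in particular $F^{*}=F^{*2}\cup -F^{*2}$. 1. If $F$ is quadratically closed, then $(\sqrt{}/F)^{(3)}=F=F^{(n)}$ for every integer $n\ge 1$. 2. If $F$ is Euclidean, then $(\sqrt{}/F)^{(3)}=F^{(2)}=F^{(n)}$ for every integer $n\ge 2$. 3. If $F$ is neither quadratically closed nor Euclidean, then $F^{(5)}$ and $(\sqrt{}/F)^{(3)}$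 are Galois over $F$, $(\sqrt{}/F)^{(3)}\subset F^{(5)}$, the exponent of $\mathrm{Gal}(F^{(5)}/F)$ is $16$, and the exponent of $\mathrm{Gal}((\sqrt{}/F)^{(3)}/F)$ is $8$. In particular $(\sqrt{}/F)^{(3)}\ne F^{(5)}$. -/

import Mathlib

/-!
Throughout, `Ω` is an algebraic closure of the base field, and all extensions of the base field are
taken inside `Ω`.  In characteristic different from two every quadratic extension is obtained by
adjoining a square root, so all fields defined here lie in the quadratic closure.
-/

namespace QuadTower

/-- The quadratic closure `F_q` of `F` in `Ω`: the smallest extension of `F` inside `Ω` that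
contains all square roots (in `Ω`) of its elements. -/
def quadraticClosure (F Ω : Type*) [Field F] [Field Ω] [Algebra F Ω] : IntermediateField F Ω :=
  sInf {K | ∀ x : Ω, x ^ 2 ∈ K → x ∈ K}

/-- `F` is quadratically closed if `F_q = F`. -/
def IsQuadraticallyClosed (F Ω : Type*) [Field F] [Field Ω] [Algebra F Ω] : Prop :=
  quadraticClosure F Ω = ⊥

/-- A set `P` of nonzero elements of a field `F` is (the set of positive elements of) an ordering
of `F`, if it is closed under addition and multiplication, and `P ∪ -P = F \ {0}`.
(It follows that `P` and `-P` are disjoint.) -/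
structure IsFieldOrdering {F : Type*} [Field F] (P : Set F) : Prop where
  zero_notMem : (0 : F) ∉ P
  add_mem : ∀ x ∈ P, ∀ y ∈ P, x + y ∈ P
  mul_mem : ∀ x ∈ P, ∀ y ∈ P, x * y ∈ P
  mem_or_neg_mem : ∀ x : F, x ≠ 0 → x ∈ P ∨ -x ∈ P

/-- `F` is a Euclidean field: the set of squares of nonzero elements is an ordering of `F`. -/
def IsEuclideanField (F : Type*) [Field F] : Prop :=
  IsFieldOrdering {x : F | ∃ y : F, y ≠ 0 ∧ x = y ^ 2}

/-- The compositum of all quadratic extensions `E` of `K` (inside `Ω`) that are Galois over `F`,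
as an extension of `F`.  The compositum is formed over `K`; it is `K` if there is no such `E`. -/
def nextLayer {F Ω : Type*} [Field F] [Field Ω] [Algebra F Ω] (K : IntermediateField F Ω) :
    IntermediateField F Ω :=
  (⨆ (E : IntermediateField K Ω)
    (_ : Module.finrank K E = 2 ∧ IsGalois F (E.restrictScalars F)), E).restrictScalars F

/-- The tower `F = F^(1) ⊆ F^(2) ⊆ F^(3) ⊆ ⋯`, where `F^(n+1)` is the compositum of all quadratic
extensions of `F^(n)` that are Galois over `F`.  The value at the index `0` is irrelevant. -/
def layer (F Ω : Type*) [Field F] [Field Ω] [Algebra F Ω] : ℕ → IntermediateField F Ω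
  | 0 => ⊥
  | 1 => ⊥
  | n + 2 => nextLayer (layer F Ω (n + 1))

/-- The field `(√/F)^(3)`: the compositum of the fields `L^(3)`, where `L` runs over all quadratic
extensions of `F` inside `Ω`.  It is `F` if there is no such `L`. -/
def sqrtLayerThree (F Ω : Type*) [Field F] [Field Ω] [Algebra F Ω] : IntermediateField F Ω :=
  ⨆ (L : IntermediateField F Ω) (_ : Module.finrank F L = 2), (layer L Ω 3).restrictScalars F

end QuadTower

/-!
Write `G` for the automorphism group of `Ω` over `F`.  For `K` Galois over `F`, the next layer over
`K` is generated by the `x` with `x ^ 2 ∈ K` all of whose quotients `σ x / x`, `σ ∈ G`, lie in `K`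
(`mem_nextLayer`, `nextLayer_le`).  All assertions about the layers follow from this description; in
the Euclidean case it is used together with the fact that `F(√-1)` contains the square roots of its
elements (`mem_adjoin_of_sq_mem_adjoin`).

*Upper bounds.*  An automorphism that fixes `K` sends such an `x` to `x` or `-x`, so its square fixes
the next layer (`pow_two_pow_apply_eq_of_mem_layer`).  Hence the exponent of `Gal(F^(5)/F)` divides
`16`; and that of `Gal((√/F)^(3)/F)` divides `8`, as squares of automorphisms fix each quadratic
extension `L` of `F`, and fourth powers of automorphisms over `L` fix `L^(3)`.

*The inclusion.*  If `x` generates a part of `L^(2)` over `L`, then `σ x * x` is a square root of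
the norm of `x ^ 2` for each `σ` nontrivial on `L`, which gives `L^(2) ⊆ F^(3)`.  If `x`
generates a part of `L^(3)` over `L^(2)` and `g` is nontrivial on `L`, then `x * g x` lies in `F^(4)`,
and this forces `x ∈ F^(5)` (`layer_three_le_layer_five`).

*Lower bounds.*  If `τ` fixes `√-1` and negates `x`, then `τ ^ 2` negates `√x` (`sq_apply_eq_neg`).
So whenever an iterated square root is negated by some power of an automorphism that fixes `√-1`,
each further square root doubles the order.  If some `√a` with `a ∈ F` is not in `F(√-1)`, this
applies to `a^(1/16) ∈ F^(5)` and to `a^(1/8) ∈ F(√a)^(3)`.  Otherwise `F(√-1)` is the only quadratic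
extension of `F`; as `F` is not Euclidean, `-1` is then a sum of two squares
(`exists_sq_add_sq_eq_neg_one`), hence the norm of some `u ∈ F(√-1)`, and `F(√u)/F` is cyclic of
degree four.  Here the roots `u^(1/8) ∈ F^(5)` and `u^(1/4) ∈ F(√-1)^(3)` have the required orders.
The roots of unity that occur as quotients of conjugates lie in low layers: the eighth roots of
unity in `F^(2)`, the sixteenth roots of unity in `F^(3)`.
-/

/-! ### Quadratic extensions in characteristic different from two -/

section Quadratic

open IntermediateField Polynomial

variable {K Ω : Type*} [Field K] [Field Ω] [Algebra K Ω]

theorem exists_eq_add_mul_of_finrank_eq_two {E : IntermediateField K Ω}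
    (hE : Module.finrank K E = 2) {e : Ω} (heE : e ∈ E) (he : e ∉ (⊥ : IntermediateField K Ω))
    {z : Ω} (hz : z ∈ E) : ∃ p q : K, z = algebraMap K Ω p + algebraMap K Ω q * e := by
  have hli : LinearIndependent K ![(1 : E), ⟨e, heE⟩] := by
    rw [LinearIndependent.pair_iff]
    intro s t hst
    have hst' : algebraMap K Ω s + algebraMap K Ω t * e = 0 := by
      have := congrArg (Subtype.val) hst
      simpa [Algebra.smul_def] using this
    have ht : t = 0 := by
      by_contra ht
      refine he (mem_bot.2 ⟨-s / t, ?_⟩)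
      have : algebraMap K Ω t ≠ 0 := by simpa using ht
      rw [map_div₀, map_neg]
      field_simp
      linear_combination -hst'
    subst ht
    exact ⟨by simpa using hst', rfl⟩
  have hspan := hli.span_eq_top_of_card_eq_finrank (by simp [hE])
  have : (⟨z, hz⟩ : E) ∈ Submodule.span K (Set.range ![(1 : E), ⟨e, heE⟩]) := by
    rw [hspan]; trivial
  rw [Matrix.range_cons, Matrix.range_cons, Matrix.range_empty, Set.union_empty,
    Set.singleton_union, Submodule.mem_span_pair] at this
  obtain ⟨p, q, hpq⟩ := this
  have := congrArg (Subtype.val) hpq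
  exact ⟨p, q, by simpa [Algebra.smul_def] using this.symm⟩

/-- Completing the square: outside characteristic two, a quadratic extension is generated by a
square root. -/
theorem exists_sqrt_generator_of_finrank_eq_two (h2 : (2 : Ω) ≠ 0) {E : IntermediateField K Ω}
    (hE : Module.finrank K E = 2) :
    ∃ x ∈ E, x ∉ (⊥ : IntermediateField K Ω) ∧ x ^ 2 ∈ (⊥ : IntermediateField K Ω) ∧
      ∀ e ∈ E, ∃ p q : K, e = algebraMap K Ω p + algebraMap K Ω q * x := by
  have hne : ¬ E ≤ ⊥ := by
    intro h
    have := finrank_eq_one_iff.2 (le_bot_iff.1 h)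
    omega
  obtain ⟨e, heE, he⟩ := SetLike.not_le_iff_exists.1 hne
  have key := fun z (hz : z ∈ E) ↦ exists_eq_add_mul_of_finrank_eq_two hE heE he hz
  obtain ⟨c, b, hcb⟩ := key (e ^ 2) (pow_mem heE 2)
  have hb : algebraMap K Ω (b / 2) * 2 = algebraMap K Ω b := by
    rw [map_div₀, map_ofNat, div_mul_cancel₀ _ h2]
  refine ⟨e - algebraMap K Ω (b / 2), sub_mem heE (E.algebraMap_mem _), ?_, ?_, ?_⟩
  · intro h
    exact he (by simpa using add_mem h ((⊥ : IntermediateField K Ω).algebraMap_mem (b / 2)))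
  · refine mem_bot.2 ⟨c + (b / 2) ^ 2, ?_⟩
    rw [map_add, map_pow]
    linear_combination -hcb + e * hb
  · intro z hz
    obtain ⟨p, q, hpq⟩ := key z hz
    refine ⟨p + q * (b / 2), q, ?_⟩
    rw [map_add, map_mul, hpq]
    ring

theorem finrank_adjoin_sqrt [Algebra.IsAlgebraic K Ω] {x : Ω}
    (hx : x ∉ (⊥ : IntermediateField K Ω)) (hx2 : x ^ 2 ∈ (⊥ : IntermediateField K Ω)) :
    Module.finrank K K⟮x⟯ = 2 := by
  have hint : IsIntegral K x := Algebra.IsIntegral.isIntegral x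
  rw [adjoin.finrank hint]
  obtain ⟨d, hd⟩ := mem_bot.1 hx2
  have hle : (minpoly K x).natDegree ≤ 2 := by
    rw [← natDegree_X_pow_sub_C (n := 2) (r := d)]
    exact natDegree_le_natDegree
      (minpoly.min K x (monic_X_pow_sub_C d two_ne_zero) (by simp [hd]))
  have h1 : (minpoly K x).natDegree ≠ 1 := fun h ↦ hx (mem_bot.2 (minpoly.natDegree_eq_one_iff.1 h))
  have h0 := minpoly.natDegree_pos hint
  omega

theorem isSeparable_of_sq_mem_bot (h2 : (2 : Ω) ≠ 0) {x : Ω}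
    (hx2 : x ^ 2 ∈ (⊥ : IntermediateField K Ω)) : IsSeparable K x := by
  obtain rfl | hx := eq_or_ne x 0
  · simpa using isSeparable_algebraMap (F := K) (K := Ω) 0
  obtain ⟨d, hd⟩ := mem_bot.1 hx2
  have hd0 : d ≠ 0 := by
    rintro rfl
    exact hx (pow_eq_zero_iff two_ne_zero |>.1 (by simpa using hd.symm))
  have h2K : ((2 : ℕ) : K) ≠ 0 := by
    intro h
    apply h2
    rw [← map_ofNat (algebraMap K Ω) 2]
    simpa only [Nat.cast_ofNat, map_zero] using congrArg (algebraMap K Ω) h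
  exact (separable_X_pow_sub_C d h2K hd0).of_dvd (minpoly.dvd K x (by simp [hd]))

/-- A square root outside the base field is moved to its negative by an automorphism. -/
theorem exists_algEquiv_eq_neg [Normal K Ω] (h2 : (2 : Ω) ≠ 0) {x : Ω}
    (hx : x ∉ (⊥ : IntermediateField K Ω)) (hx2 : x ^ 2 ∈ (⊥ : IntermediateField K Ω)) :
    ∃ σ : Gal(Ω/K), σ x = -x := by
  obtain ⟨y, hy, hxy⟩ := (notMem_iff_exists_ne_and_isConjRoot (isSeparable_of_sq_mem_bot h2 hx2)
    (Normal.splits' x)).1 hx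
  obtain ⟨σ, rfl⟩ := hxy.symm.exists_algEquiv
  refine ⟨σ, ?_⟩
  obtain ⟨d, hd⟩ := mem_bot.1 hx2
  have hsq : (σ x) ^ 2 = x ^ 2 := by rw [← map_pow, ← hd, AlgEquiv.commutes]
  exact (sq_eq_sq_iff_eq_or_eq_neg.1 hsq).resolve_left (Ne.symm hy)

end Quadratic

namespace QuadTower

open IntermediateField

variable {F Ω : Type*} [Field F] [Field Ω] [Algebra F Ω]

/-! ### Generators of the layers -/

theorem le_nextLayer (K : IntermediateField F Ω) : K ≤ nextLayer K := by
  intro x hx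
  exact (mem_restrictScalars F).2 (IntermediateField.algebraMap_mem _ (⟨x, hx⟩ : K))

theorem mem_bot_of_mem {K : IntermediateField F Ω} {x : Ω} (hx : x ∈ K) :
    x ∈ (⊥ : IntermediateField K Ω) :=
  mem_bot.2 ⟨⟨x, hx⟩, rfl⟩

theorem mem_of_mem_bot {K : IntermediateField F Ω} {x : Ω}
    (hx : x ∈ (⊥ : IntermediateField K Ω)) : x ∈ K := by
  obtain ⟨y, rfl⟩ := mem_bot.1 hx
  exact y.2

theorem normal_of_forall_mem [Normal F Ω] {K : IntermediateField F Ω}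
    (h : ∀ σ : Gal(Ω/F), ∀ x ∈ K, σ x ∈ K) : Normal F K := by
  rw [normal_iff_forall_map_le']
  rintro σ _ ⟨x, hx, rfl⟩
  exact h σ x hx

theorem algEquiv_mem [Normal F Ω] {K : IntermediateField F Ω} [Normal F K] (σ : Gal(Ω/F)) {x : Ω}
    (hx : x ∈ K) : σ x ∈ K :=
  normal_iff_forall_map_le'.1 ‹_› σ ⟨x, hx, rfl⟩

/-- For `K` Galois over `F`, the next layer contains each square root `x` of an element of `K`
for which all conjugates of `x` over `F` are `K`-multiples of `x`. -/
theorem mem_nextLayer [Normal F Ω] (h2 : (2 : Ω) ≠ 0) {K : IntermediateField F Ω} [IsGalois F K]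
    {x : Ω} (hx2 : x ^ 2 ∈ K) (hσ : ∀ σ : Gal(Ω/F), ∃ y ∈ K, σ x = y * x) : x ∈ nextLayer K := by
  by_cases hx : x ∈ K
  · exact le_nextLayer K hx
  have hxb : x ∉ (⊥ : IntermediateField K Ω) := fun h ↦ hx (mem_of_mem_bot h)
  have hGal : IsGalois F (K⟮x⟯.restrictScalars F) := by
    have hsep : Algebra.IsSeparable K K⟮x⟯ :=
      (isSeparable_adjoin_simple_iff_isSeparable K Ω).2
        (isSeparable_of_sq_mem_bot h2 (mem_bot_of_mem hx2))
    refine isGalois_iff.2 ⟨Algebra.IsSeparable.trans F K K⟮x⟯, normal_of_forall_mem ?_⟩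
    intro σ
    have hle : K⟮x⟯.restrictScalars F ≤ (K⟮x⟯.restrictScalars F).comap σ.toAlgHom := by
      rw [restrictScalars_adjoin, adjoin_le_iff]
      rintro z (hz | rfl)
      · exact subset_adjoin F _ (Or.inl (algEquiv_mem σ hz))
      · obtain ⟨y, hy, hyz⟩ := hσ σ
        change σ z ∈ adjoin F ((K : Set Ω) ∪ {z})
        rw [hyz]
        exact mul_mem (subset_adjoin F _ (Or.inl hy)) (subset_adjoin F _ (Or.inr rfl))
    exact hle
  refine (mem_restrictScalars F).2 ?_
  have hle : K⟮x⟯ ≤ ⨆ (E : IntermediateField K Ω)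
      (_ : Module.finrank K E = 2 ∧ IsGalois F (E.restrictScalars F)), E :=
    le_iSup₂_of_le K⟮x⟯ ⟨finrank_adjoin_sqrt hxb (mem_bot_of_mem hx2), hGal⟩ le_rfl
  exact hle (mem_adjoin_simple_self K x)

/-- The elements provided by `mem_nextLayer` generate the next layer.  The target `M` is only
assumed to be a subfield of `Ω`, so that preimages under automorphisms not fixing `F` qualify. -/
theorem nextLayer_le [Normal F Ω] (h2 : (2 : Ω) ≠ 0) {K : IntermediateField F Ω} [IsGalois F K]
    {M : Subfield Ω} (hKM : K.toSubfield ≤ M)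
    (hM : ∀ x : Ω, x ≠ 0 → x ^ 2 ∈ K → (∀ σ : Gal(Ω/F), ∃ y ∈ K, σ x = y * x) → x ∈ M) :
    (nextLayer K).toSubfield ≤ M := by
  let M' : IntermediateField K Ω := { M with algebraMap_mem' := fun y ↦ hKM y.2 }
  suffices h : (⨆ (E : IntermediateField K Ω)
      (_ : Module.finrank K E = 2 ∧ IsGalois F (E.restrictScalars F)), E) ≤ M' from
    fun x hx ↦ h hx
  refine iSup₂_le fun E ⟨hE, hGal⟩ ↦ ?_
  obtain ⟨x, hxE, hx, hx2, hgen⟩ := exists_sqrt_generator_of_finrank_eq_two h2 hE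
  have hxK : x ∉ K := fun h ↦ hx (mem_bot_of_mem h)
  have hx2K := mem_of_mem_bot hx2
  have hx0 : x ≠ 0 := by
    rintro rfl
    exact hxK (zero_mem K)
  have hxM : x ∈ M := by
    refine hM x hx0 hx2K fun σ ↦ ?_
    obtain ⟨p, q, hpq⟩ := hgen (σ x) (algEquiv_mem (K := E.restrictScalars F) σ hxE)
    have hp : (algebraMap K Ω p) ∈ K := p.2
    have hq : (algebraMap K Ω q) ∈ K := q.2
    have hsq : (σ x) ^ 2 ∈ K := by
      rw [← map_pow]
      exact algEquiv_mem σ hx2K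
    -- `σ x = p + q x` has its square in `K`, so `2 p q x ∈ K`; and `q = 0` would give `x ∈ K`
    have hpqx : algebraMap K Ω p * algebraMap K Ω q * x ∈ K := by
      have h2K : (2 : Ω) ∈ K := ofNat_mem K 2
      have : algebraMap K Ω p * algebraMap K Ω q * x =
          ((σ x) ^ 2 - (algebraMap K Ω p) ^ 2 - (algebraMap K Ω q) ^ 2 * x ^ 2) / 2 := by
        rw [hpq]
        field_simp
        ring
      rw [this]
      exact div_mem (sub_mem (sub_mem hsq (pow_mem hp 2)) (mul_mem (pow_mem hq 2) hx2K)) h2K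
    have hpq0 : algebraMap K Ω p * algebraMap K Ω q = 0 := by
      by_contra h
      refine hxK ?_
      have := div_mem hpqx (mul_mem hp hq)
      rwa [mul_div_cancel_left₀ _ h] at this
    rcases mul_eq_zero.1 hpq0 with h | h
    · exact ⟨_, hq, by rw [hpq, h, zero_add]⟩
    · refine absurd ?_ hxK
      have hmem : σ x ∈ K := by
        rw [hpq, h, zero_mul, add_zero]
        exact hp
      simpa using algEquiv_mem σ⁻¹ hmem
  intro e he
  obtain ⟨p, q, rfl⟩ := hgen e he
  exact add_mem (hKM p.2) (mul_mem (hKM q.2) hxM)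

theorem isGalois_nextLayer [Normal F Ω] (h2 : (2 : Ω) ≠ 0) (K : IntermediateField F Ω)
    [IsGalois F K] : IsGalois F (nextLayer K) := by
  refine isGalois_iff.2 ⟨?_, normal_of_forall_mem fun σ ↦ ?_⟩
  · rw [← le_separableClosure_iff]
    refine nextLayer_le (M := (separableClosure F Ω).toSubfield) h2
      (le_separableClosure F Ω K) fun x _ hx2 _ ↦ ?_
    exact mem_separableClosure_iff.2 (IsSeparable.of_algebra_isSeparable_of_isSeparable F (E := K)
      (isSeparable_of_sq_mem_bot h2 (mem_bot_of_mem hx2)))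
  · refine nextLayer_le (M := (nextLayer K).toSubfield.comap (σ : Ω →+* Ω)) h2
      (fun x hx ↦ le_nextLayer K (algEquiv_mem σ hx)) fun x _ hx2 hx ↦ ?_
    refine mem_nextLayer h2 ?_ fun τ ↦ ?_
    · change (σ x) ^ 2 ∈ K
      rw [← map_pow]
      exact algEquiv_mem σ hx2
    · obtain ⟨y, hy, hyx⟩ := hx (σ⁻¹ * τ * σ)
      refine ⟨σ y, algEquiv_mem σ hy, ?_⟩
      have := congrArg σ hyx
      simpa using this

/-! ### Basic properties of the layers -/

theorem isGalois_layer [Normal F Ω] (h2 : (2 : Ω) ≠ 0) : ∀ n, IsGalois F (layer F Ω n)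
  | 0 => isGalois_bot
  | 1 => isGalois_bot
  | n + 2 =>
    have := isGalois_layer h2 (n + 1)
    isGalois_nextLayer h2 _

theorem layer_mono : Monotone (layer F Ω) :=
  monotone_nat_of_le_succ fun n ↦ by
    cases n with
    | zero => exact le_rfl
    | succ n => exact le_nextLayer _

theorem algebraMap_mem_layer (n : ℕ) (a : F) : algebraMap F Ω a ∈ layer F Ω n :=
  IntermediateField.algebraMap_mem _ a

theorem mem_layer_succ [Normal F Ω] (h2 : (2 : Ω) ≠ 0) {n : ℕ} {x : Ω}
    (hx2 : x ^ 2 ∈ layer F Ω (n + 1)) (hσ : ∀ σ : Gal(Ω/F), σ x / x ∈ layer F Ω (n + 1)) :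
    x ∈ layer F Ω (n + 2) := by
  have := isGalois_layer (F := F) h2 (n + 1)
  obtain rfl | hx := eq_or_ne x 0
  · exact zero_mem _
  · exact mem_nextLayer h2 hx2 fun σ ↦ ⟨_, hσ σ, (div_mul_cancel₀ _ hx).symm⟩

theorem layer_succ_le [Normal F Ω] (h2 : (2 : Ω) ≠ 0) {n : ℕ} {M : Subfield Ω}
    (hM : (layer F Ω (n + 1)).toSubfield ≤ M)
    (h : ∀ x : Ω, x ≠ 0 → x ^ 2 ∈ layer F Ω (n + 1) →
      (∀ σ : Gal(Ω/F), σ x / x ∈ layer F Ω (n + 1)) → x ∈ M) :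
    (layer F Ω (n + 2)).toSubfield ≤ M := by
  have := isGalois_layer (F := F) h2 (n + 1)
  refine nextLayer_le h2 hM fun x hx hx2 hσ ↦ h x hx hx2 fun σ ↦ ?_
  obtain ⟨y, hy, hyx⟩ := hσ σ
  rwa [hyx, mul_div_cancel_right₀ _ hx]

theorem map_div_self_pow_eq_one {σ : Gal(Ω/F)} {x : Ω} (hx : x ≠ 0) {m : ℕ}
    (h : σ (x ^ m) = x ^ m) : (σ x / x) ^ m = 1 := by
  rw [div_pow, ← map_pow, h, div_self (pow_ne_zero m hx)]

theorem mem_layer_two_of_sq_mem [Normal F Ω] (h2 : (2 : Ω) ≠ 0) {x : Ω}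
    (hx2 : x ^ 2 ∈ (⊥ : IntermediateField F Ω)) : x ∈ layer F Ω 2 := by
  obtain rfl | hx := eq_or_ne x 0
  · exact zero_mem _
  refine mem_layer_succ h2 hx2 fun σ ↦ ?_
  obtain ⟨d, hd⟩ := mem_bot.1 hx2
  rcases sq_eq_one_iff.1 (map_div_self_pow_eq_one (σ := σ) hx (by rw [← hd, σ.commutes]))
    with h | h
  · rw [h]; exact one_mem _
  · rw [h]; exact neg_mem (one_mem _)

theorem mem_layer_two_of_pow_four_eq_one [Normal F Ω] (h2 : (2 : Ω) ≠ 0) {r : Ω}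
    (hr : r ^ 4 = 1) :
    r ∈ layer F Ω 2 := by
  refine mem_layer_two_of_sq_mem h2 ?_
  rcases sq_eq_one_iff.1 (show (r ^ 2) ^ 2 = 1 by rw [← hr]; ring) with h | h
  · rw [h]; exact one_mem _
  · rw [h]; exact neg_mem (one_mem _)

/-- Eighth roots of unity are sums of square roots of `±1`, `±1/2`. -/
theorem mem_layer_two_of_pow_eight_eq_one [Normal F Ω] (h2 : (2 : Ω) ≠ 0) {r : Ω}
    (hr : r ^ 8 = 1) : r ∈ layer F Ω 2 := by
  rcases sq_eq_one_iff.1 (show (r ^ 4) ^ 2 = 1 by rw [← hr]; ring) with h | h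
  · exact mem_layer_two_of_pow_four_eq_one h2 h
  · have hr0 : r ≠ 0 := by
      rintro rfl
      simp at hr
    have h2F : (2 : Ω) ∈ (⊥ : IntermediateField F Ω) := ofNat_mem _ 2
    have hs : r + r⁻¹ ∈ layer F Ω 2 := by
      refine mem_layer_two_of_sq_mem h2 ?_
      have : (r + r⁻¹) ^ 2 = 2 := by
        field_simp
        linear_combination h
      rwa [this]
    have hd : r - r⁻¹ ∈ layer F Ω 2 := by
      refine mem_layer_two_of_sq_mem h2 ?_
      have : (r - r⁻¹) ^ 2 = -2 := by
        field_simp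
        linear_combination h
      rw [this]
      exact neg_mem h2F
    have : r = ((r + r⁻¹) + (r - r⁻¹)) / 2 := by
      field_simp
      ring
    rw [this]
    exact div_mem (add_mem hs hd) (ofNat_mem _ 2)

theorem mem_layer_three_of_pow_sixteen_eq_one [Normal F Ω] (h2 : (2 : Ω) ≠ 0) {r : Ω}
    (hr : r ^ 16 = 1) :
    r ∈ layer F Ω 3 := by
  have hr0 : r ≠ 0 := by
    rintro rfl
    simp at hr
  refine mem_layer_succ h2 (mem_layer_two_of_pow_eight_eq_one h2 (by rw [← hr]; ring)) fun σ ↦ ?_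
  refine mem_layer_two_of_pow_eight_eq_one h2 (map_div_self_pow_eq_one hr0 ?_)
  rcases sq_eq_one_iff.1 (show (r ^ 8) ^ 2 = 1 by rw [← hr]; ring) with h | h <;> simp [h]

/-! ### Exponents of Galois groups -/

/-- An automorphism that fixes a layer maps each generator of the next layer to itself or its
negative, so the exponent of the Galois group at most doubles in each step. -/
theorem pow_two_pow_apply_eq_of_mem_layer [Normal F Ω] (h2 : (2 : Ω) ≠ 0) (σ : Gal(Ω/F)) :
    ∀ n, ∀ x ∈ layer F Ω (n + 1), (σ ^ 2 ^ n) x = x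
  | 0, x, hx => by
    obtain ⟨a, rfl⟩ := mem_bot.1 (show x ∈ (⊥ : IntermediateField F Ω) from hx)
    exact (σ ^ 2 ^ 0).commutes a
  | n + 1, x, hx => by
    have ih := pow_two_pow_apply_eq_of_mem_layer h2 σ n
    have hsucc : σ ^ 2 ^ (n + 1) = σ ^ 2 ^ n * σ ^ 2 ^ n := by rw [pow_succ, mul_two, pow_add]
    refine layer_succ_le (M := RingHom.eqLocusField ((σ ^ 2 ^ (n + 1) : Gal(Ω/F)) : Ω →+* Ω)
      (RingHom.id Ω)) h2 (fun y hy ↦ ?_) (fun y hy hy2 _ ↦ ?_) hx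
    · change (σ ^ 2 ^ (n + 1)) y = y
      rw [hsucc, AlgEquiv.mul_apply, ih y hy, ih y hy]
    · change (σ ^ 2 ^ (n + 1)) y = y
      have hsq : ((σ ^ 2 ^ n) y) ^ 2 = y ^ 2 := by rw [← map_pow, ih _ hy2]
      rw [hsucc, AlgEquiv.mul_apply]
      rcases sq_eq_sq_iff_eq_or_eq_neg.1 hsq with h | h
      · rw [h, h]
      · rw [h, map_neg, h, neg_neg]

/-- If `τ` fixes `√-1` and negates `x`, then `τ` maps a square root `y` of `x` to `√-1 * y` or
`-√-1 * y`.  Since `τ ^ 2` fixes `√-1` again, each further square root doubles the order. -/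
theorem sq_apply_eq_neg {τ : Gal(Ω/F)} {i x y : Ω} (hi : i ^ 2 = -1) (hτi : τ i = i)
    (hτx : τ x = -x) (hy : y ^ 2 = x) : (τ ^ 2) y = -y := by
  have h : (τ y) ^ 2 = (i * y) ^ 2 := by
    rw [← map_pow, hy, hτx, mul_pow, hi, hy, neg_one_mul]
  rw [pow_two, AlgEquiv.mul_apply]
  rcases sq_eq_sq_iff_eq_or_eq_neg.1 h with h | h
  · rw [h, map_mul, hτi, h]
    linear_combination y * hi
  · rw [h, map_neg, map_mul, hτi, h]
    linear_combination y * hi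

theorem exponent_eq_two_pow [Normal F Ω] {K : IntermediateField F Ω} (hK : IsGalois F K) {n : ℕ}
    (hle : ∀ σ : Gal(Ω/F), ∀ x ∈ K, (σ ^ 2 ^ (n + 1)) x = x)
    (hge : ∃ σ : Gal(Ω/F), ∃ x ∈ K, (σ ^ 2 ^ n) x ≠ x) :
    Monoid.exponent Gal(K/F) = 2 ^ (n + 1) := by
  have hone : ∀ (σ : Gal(Ω/F)) (m : ℕ),
      AlgEquiv.restrictNormalHom K σ ^ m = 1 ↔ ∀ x ∈ K, (σ ^ m) x = x := by
    intro σ m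
    rw [← map_pow, AlgEquiv.ext_iff]
    constructor
    · intro h x hx
      have := congrArg Subtype.val (h ⟨x, hx⟩)
      rwa [AlgEquiv.restrictNormalHom_apply] at this
    · rintro h ⟨x, hx⟩
      apply Subtype.ext
      rw [AlgEquiv.restrictNormalHom_apply]
      exact h x hx
  have hdvd : Monoid.exponent Gal(K/F) ∣ 2 ^ (n + 1) := by
    refine Monoid.exponent_dvd_of_forall_pow_eq_one fun g ↦ ?_
    obtain ⟨σ, rfl⟩ := AlgEquiv.restrictNormalHom_surjective (F := F) (K₁ := K) Ω g
    exact (hone σ _).2 (hle σ)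
  refine Nat.dvd_antisymm hdvd ?_
  obtain ⟨σ, x, hx, hσx⟩ := hge
  have hord : orderOf (AlgEquiv.restrictNormalHom K σ) = 2 ^ (n + 1) :=
    orderOf_eq_prime_pow (fun h ↦ hσx ((hone σ _).1 h x hx)) ((hone σ _).2 (hle σ))
  rw [← hord]
  exact Monoid.order_dvd_exponent _

/-! ### The layers of a quadratic extension -/

theorem eq_or_eq_neg_of_sq_mem_bot {x : Ω} (hx2 : x ^ 2 ∈ (⊥ : IntermediateField F Ω))
    (σ : Gal(Ω/F)) : σ x = x ∨ σ x = -x := by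
  obtain ⟨d, hd⟩ := mem_bot.1 hx2
  refine sq_eq_sq_iff_eq_or_eq_neg.1 ?_
  rw [← map_pow, ← hd, σ.commutes]

theorem exists_sqrt_generator (h2 : (2 : Ω) ≠ 0) {L : IntermediateField F Ω}
    (hL : Module.finrank F L = 2) :
    ∃ x ∉ (⊥ : IntermediateField F Ω), x ^ 2 ∈ (⊥ : IntermediateField F Ω) ∧ L = F⟮x⟯ := by
  obtain ⟨x, hxL, hx, hx2, hgen⟩ := exists_sqrt_generator_of_finrank_eq_two h2 hL
  refine ⟨x, hx, hx2, le_antisymm (fun e he ↦ ?_) (adjoin_simple_le_iff.2 hxL)⟩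
  obtain ⟨p, q, rfl⟩ := hgen e he
  exact add_mem (IntermediateField.algebraMap_mem _ p)
    (mul_mem (IntermediateField.algebraMap_mem _ q) (mem_adjoin_simple_self F x))

theorem isGalois_of_finrank_eq_two (h2 : (2 : Ω) ≠ 0) {L : IntermediateField F Ω}
    (hL : Module.finrank F L = 2) : IsGalois F L := by
  obtain ⟨x, -, hx2, rfl⟩ := exists_sqrt_generator h2 hL
  have : Algebra.IsQuadraticExtension F F⟮x⟯ := ⟨hL⟩
  have : Algebra.IsSeparable F F⟮x⟯ :=
    (isSeparable_adjoin_simple_iff_isSeparable F Ω).2 (isSeparable_of_sq_mem_bot h2 hx2)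
  infer_instance

theorem le_layer_two_of_finrank_eq_two [Normal F Ω] (h2 : (2 : Ω) ≠ 0) {L : IntermediateField F Ω}
    (hL : Module.finrank F L = 2) : L ≤ layer F Ω 2 := by
  obtain ⟨x, -, hx2, rfl⟩ := exists_sqrt_generator h2 hL
  exact adjoin_simple_le_iff.2 (mem_layer_two_of_sq_mem h2 hx2)

theorem mem_fixingSubgroup_adjoin_simple {x : Ω} {σ : Gal(Ω/F)} (hσ : σ x = x) :
    σ ∈ (F⟮x⟯).fixingSubgroup := by
  refine (le_iff_le (Subgroup.zpowers σ) F⟮x⟯).1 (adjoin_simple_le_iff.2 ?_)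
    (Subgroup.mem_zpowers σ)
  have hle : Subgroup.zpowers σ ≤ MulAction.stabilizer Gal(Ω/F) x := Subgroup.zpowers_le.2 hσ
  exact (mem_fixedField_iff _ _).2 fun f hf ↦ hle hf

theorem sq_mem_fixingSubgroup (h2 : (2 : Ω) ≠ 0) {L : IntermediateField F Ω}
    (hL : Module.finrank F L = 2) (σ : Gal(Ω/F)) : σ ^ 2 ∈ L.fixingSubgroup := by
  obtain ⟨x, -, hx2, rfl⟩ := exists_sqrt_generator h2 hL
  refine mem_fixingSubgroup_adjoin_simple ?_
  rw [pow_two, AlgEquiv.mul_apply]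
  rcases eq_or_eq_neg_of_sq_mem_bot hx2 σ with h | h <;> simp [h]

/-- A nontrivial conjugation of `L/F` together with the subgroup fixing `L` exhausts the Galois
group. -/
theorem exists_forall_mem_fixingSubgroup_or [Normal F Ω] (h2 : (2 : Ω) ≠ 0)
    {L : IntermediateField F Ω} (hL : Module.finrank F L = 2) :
    ∃ g : Gal(Ω/F), ∀ σ : Gal(Ω/F), σ ∈ L.fixingSubgroup ∨ g⁻¹ * σ ∈ L.fixingSubgroup := by
  obtain ⟨x, hx, hx2, rfl⟩ := exists_sqrt_generator h2 hL
  obtain ⟨g, hg⟩ := exists_algEquiv_eq_neg h2 hx hx2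
  refine ⟨g, fun σ ↦ ?_⟩
  rcases eq_or_eq_neg_of_sq_mem_bot hx2 σ with h | h
  · exact Or.inl (mem_fixingSubgroup_adjoin_simple h)
  · refine Or.inr (mem_fixingSubgroup_adjoin_simple ?_)
    rw [AlgEquiv.mul_apply, h, ← hg]
    simp

/-- For `σ` nontrivial on `L` and `b ∈ L`, the product `σ b * b` is the norm of `b`. -/
theorem mem_fixingSubgroup_or_mul_mem_bot (h2 : (2 : Ω) ≠ 0)
    {L : IntermediateField F Ω} (hL : Module.finrank F L = 2) (σ : Gal(Ω/F)) :
    σ ∈ L.fixingSubgroup ∨ ∀ b ∈ L, σ b * b ∈ (⊥ : IntermediateField F Ω) := by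
  obtain ⟨x, hxL, -, hx2, hgen⟩ := exists_sqrt_generator_of_finrank_eq_two h2 hL
  rcases eq_or_eq_neg_of_sq_mem_bot hx2 σ with h | h
  · refine Or.inl ((mem_fixingSubgroup_iff _ _).2 fun b hb ↦ ?_)
    obtain ⟨p, q, rfl⟩ := hgen b hb
    simp [h]
  · refine Or.inr fun b hb ↦ ?_
    obtain ⟨p, q, rfl⟩ := hgen b hb
    have : σ (algebraMap F Ω p + algebraMap F Ω q * x) * (algebraMap F Ω p + algebraMap F Ω q * x) =
        algebraMap F Ω p ^ 2 - algebraMap F Ω q ^ 2 * x ^ 2 := by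
      rw [map_add, map_mul, σ.commutes, σ.commutes, h]
      ring
    rw [this]
    exact sub_mem (pow_mem (IntermediateField.algebraMap_mem _ p) 2)
      (mul_mem (pow_mem (IntermediateField.algebraMap_mem _ q) 2) hx2)

/-- The layers over a normal extension `L` of `F` are stable under automorphisms over `F`. -/
theorem algEquiv_mem_layer_of_normal [Normal F Ω] (h2 : (2 : Ω) ≠ 0) (L : IntermediateField F Ω)
    [Normal F L] (g : Gal(Ω/F)) : ∀ n, ∀ x ∈ layer L Ω (n + 1), g x ∈ layer L Ω (n + 1)
  | 0, x, hx => by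
    have hxL : x ∈ L := mem_of_mem_bot hx
    exact mem_bot_of_mem (algEquiv_mem g hxL)
  | n + 1, x, hx => by
    have ih := algEquiv_mem_layer_of_normal h2 L g n
    refine layer_succ_le (F := L) (M := (layer L Ω (n + 2)).toSubfield.comap (g : Ω →+* Ω)) h2
      (fun y hy ↦ layer_mono (Nat.le_succ _) (ih y hy)) (fun y _ hy2 hy ↦ ?_) hx
    refine mem_layer_succ h2 ?_ fun τ ↦ ?_
    · change (g y) ^ 2 ∈ _
      rw [← map_pow]
      exact ih _ hy2
    · have hτ : g⁻¹ * τ.restrictScalars F * g ∈ L.fixingSubgroup := by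
        refine (mem_fixingSubgroup_iff _ _).2 fun z hz ↦ ?_
        have : τ (g z) = g z := τ.commutes (⟨g z, algEquiv_mem g hz⟩ : L)
        simp [this]
      have := ih _ (hy (L.fixingSubgroupEquiv ⟨_, hτ⟩))
      have heq : g ((L.fixingSubgroupEquiv ⟨_, hτ⟩ : Gal(Ω/L)) y / y) = τ (g y) / g y := by
        rw [map_div₀]
        congr 1
        change g ((g⁻¹ * τ.restrictScalars F * g) y) = _
        simp
      rwa [heq] at this

theorem layer_two_le_layer_three [Normal F Ω] (h2 : (2 : Ω) ≠ 0) {L : IntermediateField F Ω}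
    (hL : Module.finrank F L = 2) : (layer L Ω 2).restrictScalars F ≤ layer F Ω 3 := by
  have hL2 := le_layer_two_of_finrank_eq_two h2 hL
  refine layer_succ_le (F := L) (n := 0) (M := (layer F Ω 3).toSubfield) h2
    (fun y hy ↦ layer_mono (by norm_num) (hL2 (mem_of_mem_bot hy))) fun x hx hx2 _ ↦ ?_
  have hx2L : x ^ 2 ∈ L := mem_of_mem_bot hx2
  refine mem_layer_succ h2 (hL2 hx2L) fun σ ↦ ?_
  rcases mem_fixingSubgroup_or_mul_mem_bot h2 hL σ with hσ | hσ
  · refine mem_layer_two_of_pow_four_eq_one h2 ?_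
    have := map_div_self_pow_eq_one (m := 2) hx ((mem_fixingSubgroup_iff _ _).1 hσ _ hx2L)
    linear_combination ((σ x / x) ^ 2 + 1) * this
  · have hmul : σ x * x ∈ layer F Ω 2 := by
      refine mem_layer_two_of_sq_mem h2 ?_
      rw [mul_pow, ← map_pow]
      exact hσ _ hx2L
    have : σ x / x = σ x * x / x ^ 2 := by field_simp
    rw [this]
    exact div_mem hmul (hL2 hx2L)

/-- For a generator `x` of `L^(3)` over `L^(2)` and a conjugation `g` of `L/F`, the product `x * g x`
lies in `F^(4)`, because `L^(2)` contains its quotients with all of its conjugates.  This puts `x`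
into `F^(5)`. -/
theorem layer_three_le_layer_five [Normal F Ω] (h2 : (2 : Ω) ≠ 0) {L : IntermediateField F Ω}
    (hL : Module.finrank F L = 2) : (layer L Ω 3).restrictScalars F ≤ layer F Ω 5 := by
  have := isGalois_of_finrank_eq_two h2 hL
  have hL23 := layer_two_le_layer_three h2 hL
  have hmono34 : layer F Ω 3 ≤ layer F Ω 4 := layer_mono (by norm_num)
  have hstab := fun (g : Gal(Ω/F)) ↦ algEquiv_mem_layer_of_normal h2 L g 1
  refine layer_succ_le (F := L) (n := 1) (M := (layer F Ω 5).toSubfield) h2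
    (fun y hy ↦ layer_mono (by norm_num) (hL23 hy)) fun x hx hx2 hxL ↦ ?_
  have hH : ∀ σ ∈ L.fixingSubgroup, σ x / x ∈ layer L Ω 2 := fun σ hσ ↦
    hxL (L.fixingSubgroupEquiv ⟨σ, hσ⟩)
  obtain ⟨g, hg⟩ := exists_forall_mem_fixingSubgroup_or h2 hL
  have hgx : g x ≠ 0 := by simpa using hx
  -- the quotients `σ (g x) / g x` for `σ` fixing `L`
  have hHg : ∀ σ ∈ L.fixingSubgroup, σ (g x) / g x ∈ layer L Ω 2 := by
    intro σ hσ
    have hconj : g⁻¹ * σ * g ∈ L.fixingSubgroup := by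
      refine (mem_fixingSubgroup_iff _ _).2 fun z hz ↦ ?_
      have : σ (g z) = g z := (mem_fixingSubgroup_iff _ _).1 hσ _ (algEquiv_mem g hz)
      simp [this]
    have := hstab g _ (hH _ hconj)
    rw [map_div₀] at this
    simpa using this
  have hHy : ∀ σ ∈ L.fixingSubgroup, σ (x * g x) / (x * g x) ∈ layer L Ω 2 := by
    intro σ hσ
    rw [map_mul, mul_div_mul_comm]
    exact mul_mem (hH σ hσ) (hHg σ hσ)
  have hgy : g (x * g x) / (x * g x) ∈ layer L Ω 2 := by
    have : g (x * g x) / (x * g x) = (g ^ 2) x / x := by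
      rw [map_mul, pow_two, AlgEquiv.mul_apply]
      field_simp
    rw [this]
    exact hH _ (sq_mem_fixingSubgroup h2 hL g)
  have hy : x * g x ∈ layer F Ω 4 := by
    refine mem_layer_succ h2 (hL23 ?_) fun σ ↦ hL23 ?_
    · change (x * g x) ^ 2 ∈ layer L Ω 2
      rw [mul_pow, ← map_pow]
      exact mul_mem hx2 (hstab g _ hx2)
    · change σ (x * g x) / (x * g x) ∈ layer L Ω 2
      rcases hg σ with hσ | hσ
      · exact hHy σ hσ
      · have h1 := mul_mem (hstab g _ (hHy _ hσ)) hgy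
        rw [map_div₀, AlgEquiv.mul_apply, ← AlgEquiv.mul_apply g, mul_inv_cancel,
          AlgEquiv.one_apply, div_mul_div_cancel₀] at h1
        · exact h1
        · rw [map_ne_zero]
          exact mul_ne_zero hx hgx
  refine mem_layer_succ h2 (hmono34 (hL23 hx2)) fun σ ↦ ?_
  rcases hg σ with hσ | hσ
  · exact hmono34 (hL23 (hH σ hσ))
  · have h1 : g ((g⁻¹ * σ) x / x) ∈ layer F Ω 4 := hmono34 (hL23 (hstab g _ (hH _ hσ)))
    have heq : σ x / x = g ((g⁻¹ * σ) x / x) * (x * g x / x ^ 2) := by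
      rw [map_div₀, AlgEquiv.mul_apply, ← AlgEquiv.mul_apply g, mul_inv_cancel, AlgEquiv.one_apply]
      field_simp
    rw [heq]
    exact mul_mem h1 (div_mem hy (hmono34 (hL23 hx2)))

/-! ### The compositum of the third layers of the quadratic extensions -/

theorem sqrtLayerThree_le_layer_five [Normal F Ω] (h2 : (2 : Ω) ≠ 0) :
    sqrtLayerThree F Ω ≤ layer F Ω 5 :=
  iSup₂_le fun _ hL ↦ layer_three_le_layer_five h2 hL

theorem layer_three_le_sqrtLayerThree {L : IntermediateField F Ω} (hL : Module.finrank F L = 2) :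
    (layer L Ω 3).restrictScalars F ≤ sqrtLayerThree F Ω :=
  le_iSup₂_of_le (f := fun (L : IntermediateField F Ω) (_ : Module.finrank F L = 2) ↦
    (layer L Ω 3).restrictScalars F) L hL le_rfl

theorem isGalois_sqrtLayerThree [Normal F Ω] (h2 : (2 : Ω) ≠ 0) :
    IsGalois F (sqrtLayerThree F Ω) := by
  have := isGalois_layer (F := F) h2 5
  refine isGalois_iff.2 ⟨?_, normal_of_forall_mem fun σ ↦ ?_⟩
  · exact (le_separableClosure_iff F Ω _).1
      ((sqrtLayerThree_le_layer_five h2).trans (le_separableClosure F Ω _))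
  · have hle : sqrtLayerThree F Ω ≤ (sqrtLayerThree F Ω).comap σ.toAlgHom := by
      refine iSup₂_le fun L hL x hx ↦ layer_three_le_sqrtLayerThree hL ?_
      have := isGalois_of_finrank_eq_two h2 hL
      exact algEquiv_mem_layer_of_normal h2 L σ 2 x hx
    exact hle

/-- The square of an automorphism over `F` fixes `L`, and fourth powers of automorphisms over
`L` fix `L^(3)`. -/
theorem pow_two_pow_three_apply_eq_of_mem_sqrtLayerThree [Normal F Ω] (h2 : (2 : Ω) ≠ 0)
    (σ : Gal(Ω/F)) {x : Ω} (hx : x ∈ sqrtLayerThree F Ω) : (σ ^ 2 ^ 3) x = x := by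
  suffices hle : sqrtLayerThree F Ω ≤ fixedField (Subgroup.zpowers (σ ^ 2 ^ 3)) from
    (mem_fixedField_iff _ _).1 (hle hx) _ (Subgroup.mem_zpowers _)
  refine iSup₂_le fun L hL x hx ↦ (mem_fixedField_iff _ _).2 fun f hf ↦ ?_
  have hfix : (σ ^ 2 ^ 3) x = x := by
    have := pow_two_pow_apply_eq_of_mem_layer h2
      (L.fixingSubgroupEquiv ⟨σ ^ 2, sq_mem_fixingSubgroup h2 hL σ⟩) 2 x hx
    rw [← map_pow] at this
    rw [show σ ^ 2 ^ 3 = (σ ^ 2) ^ 2 ^ 2 by rw [← pow_mul]; norm_num]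
    exact this
  have hle : Subgroup.zpowers (σ ^ 2 ^ 3) ≤ MulAction.stabilizer Gal(Ω/F) x :=
    Subgroup.zpowers_le.2 hfix
  exact hle hf

/-! ### Quadratically closed and Euclidean fields -/

theorem sq_mem_bot_of_sq_eq_neg_one {i : Ω} (hi : i ^ 2 = -1) :
    i ^ 2 ∈ (⊥ : IntermediateField F Ω) := by
  rw [hi]
  exact neg_mem (one_mem _)

theorem mem_of_sq_eq_sq {K : IntermediateField F Ω} {x y : Ω} (h : x ^ 2 = y ^ 2) (hy : y ∈ K) :
    x ∈ K := by
  rcases sq_eq_sq_iff_eq_or_eq_neg.1 h with rfl | rfl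
  exacts [hy, neg_mem hy]

theorem isQuadraticallyClosed_iff :
    IsQuadraticallyClosed F Ω ↔
      ∀ x : Ω, x ^ 2 ∈ (⊥ : IntermediateField F Ω) → x ∈ (⊥ : IntermediateField F Ω) := by
  constructor
  · intro h x hx
    rw [← show quadraticClosure F Ω = ⊥ from h, quadraticClosure, mem_sInf] at hx ⊢
    exact fun K hK ↦ hK x (hx K hK)
  · exact fun h ↦ le_bot_iff.1 (sInf_le h)

theorem layer_eq_bot [Normal F Ω] (h2 : (2 : Ω) ≠ 0) (h : IsQuadraticallyClosed F Ω) :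
    ∀ n, layer F Ω n = ⊥
  | 0 => rfl
  | 1 => rfl
  | n + 2 => by
    have ih := layer_eq_bot h2 h (n + 1)
    refine le_bot_iff.1 (layer_succ_le (M := (⊥ : IntermediateField F Ω).toSubfield) h2 ih.le
      fun x _ hx2 _ ↦ isQuadraticallyClosed_iff.1 h x (ih.le hx2))

theorem sqrtLayerThree_eq_bot (h2 : (2 : Ω) ≠ 0) (h : IsQuadraticallyClosed F Ω) :
    sqrtLayerThree F Ω = ⊥ := by
  refine le_bot_iff.1 (iSup₂_le fun L hL ↦ ?_)
  obtain ⟨x, hx, hx2, -⟩ := exists_sqrt_generator h2 hL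
  exact absurd (isQuadraticallyClosed_iff.1 h x hx2) hx

theorem notMem_bot_of_isEuclideanField (hF : IsEuclideanField F) {i : Ω} (hi : i ^ 2 = -1) :
    i ∉ (⊥ : IntermediateField F Ω) := by
  intro h
  obtain ⟨y, rfl⟩ := mem_bot.1 h
  have hy : y ^ 2 = -1 := (algebraMap F Ω).injective (by simpa using hi)
  have hy0 : y ≠ 0 := by
    rintro rfl
    simp at hy
  refine hF.zero_notMem ?_
  have := hF.add_mem 1 ⟨1, one_ne_zero, by simp⟩ (-1) ⟨y, hy0, hy.symm⟩
  rwa [add_neg_cancel] at this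

theorem mem_adjoin_of_sq_mem_bot (hF : IsEuclideanField F) {i : Ω} (hi : i ^ 2 = -1) {x : Ω}
    (hx : x ^ 2 ∈ (⊥ : IntermediateField F Ω)) : x ∈ F⟮i⟯ := by
  obtain ⟨a, ha⟩ := mem_bot.1 hx
  obtain rfl | ha0 := eq_or_ne a 0
  · have : x = 0 := pow_eq_zero_iff two_ne_zero |>.1 (by simpa using ha.symm)
    rw [this]
    exact zero_mem _
  rcases hF.mem_or_neg_mem a ha0 with ⟨y, -, hy⟩ | ⟨y, -, hy⟩
  · have hsq : x ^ 2 = algebraMap F Ω y ^ 2 := by rw [← ha, hy, map_pow]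
    have hmem : algebraMap F Ω y ∈ F⟮i⟯ := IntermediateField.algebraMap_mem _ y
    exact mem_of_sq_eq_sq hsq hmem
  · have hsq : x ^ 2 = (algebraMap F Ω y * i) ^ 2 := by
      rw [← ha, mul_pow, hi, ← map_pow, ← hy, map_neg, mul_neg_one, neg_neg]
    have hmem : algebraMap F Ω y * i ∈ F⟮i⟯ :=
      mul_mem (IntermediateField.algebraMap_mem _ y) (mem_adjoin_simple_self F i)
    exact mem_of_sq_eq_sq hsq hmem

theorem exists_sq_add_sq_eq_sq (hF : IsEuclideanField F) (a b : F) : ∃ c, a ^ 2 + b ^ 2 = c ^ 2 := by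
  by_cases ha : a = 0
  · exact ⟨b, by simp [ha]⟩
  by_cases hb : b = 0
  · exact ⟨a, by simp [hb]⟩
  obtain ⟨c, -, hc⟩ := hF.add_mem _ ⟨a, ha, rfl⟩ _ ⟨b, hb, rfl⟩
  exact ⟨c, hc⟩

/-- Over a Euclidean field `F`, the field `F(√-1)` contains the square roots of its elements, by the
formula for the square root of a complex number. -/
theorem mem_adjoin_of_sq_mem_adjoin [Normal F Ω] [IsAlgClosed Ω] (h2 : (2 : Ω) ≠ 0)
    (hF : IsEuclideanField F) {i : Ω} (hi : i ^ 2 = -1) {x : Ω} (hx : x ^ 2 ∈ F⟮i⟯) :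
    x ∈ F⟮i⟯ := by
  have hib := notMem_bot_of_isEuclideanField hF hi
  have hi2 := sq_mem_bot_of_sq_eq_neg_one (F := F) hi
  obtain ⟨a, b, hab⟩ := exists_eq_add_mul_of_finrank_eq_two (finrank_adjoin_sqrt hib hi2)
    (mem_adjoin_simple_self F i) hib hx
  obtain ⟨c, hc⟩ := exists_sq_add_sq_eq_sq hF a b
  have hc' : algebraMap F Ω a ^ 2 + algebraMap F Ω b ^ 2 = algebraMap F Ω c ^ 2 := by
    simpa using congrArg (algebraMap F Ω) hc
  have hA (r : F) : algebraMap F Ω r ∈ F⟮i⟯ := IntermediateField.algebraMap_mem _ r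
  -- `√(a + b i) = s + (b / 2s) i` with `s ^ 2 = (c + a) / 2`; the sign of `c` plays no role here
  obtain ⟨s, hs⟩ := IsAlgClosed.exists_pow_nat_eq (algebraMap F Ω ((c + a) / 2)) two_pos
  have hsmem : s ∈ F⟮i⟯ := mem_adjoin_of_sq_mem_bot hF hi (mem_bot.2 ⟨_, hs.symm⟩)
  have hs' : 2 * s ^ 2 = algebraMap F Ω c + algebraMap F Ω a := by
    rw [hs, map_div₀, map_add, map_ofNat]
    field_simp
  obtain rfl | hs0 := eq_or_ne s 0
  · have hb : algebraMap F Ω b = 0 := by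
      refine pow_eq_zero_iff two_ne_zero |>.1 ?_
      linear_combination hc' + (algebraMap F Ω a - algebraMap F Ω c) * hs'
    refine mem_adjoin_of_sq_mem_bot hF hi (mem_bot.2 ⟨a, ?_⟩)
    rw [hab, hb, zero_mul, add_zero]
  · set t := algebraMap F Ω b / (2 * s) with ht
    have hts : 2 * s * t = algebraMap F Ω b := by
      rw [ht]
      field_simp
    have ht2 : 2 * t ^ 2 = algebraMap F Ω c - algebraMap F Ω a := by
      have h4 : (2 * s ^ 2) ≠ 0 := mul_ne_zero h2 (pow_ne_zero 2 hs0)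
      refine mul_left_cancel₀ h4 ?_
      linear_combination (2 * s * t + algebraMap F Ω b) * hts + hc' -
        (algebraMap F Ω c - algebraMap F Ω a) * hs'
    have hsq : x ^ 2 = (s + t * i) ^ 2 := by
      have hst : s ^ 2 - t ^ 2 = algebraMap F Ω a := by
        refine mul_left_cancel₀ h2 ?_
        linear_combination hs' - ht2
      rw [hab]
      linear_combination -hst - i * hts - t ^ 2 * hi
    have htmem : t ∈ F⟮i⟯ := div_mem (hA b) (mul_mem (ofNat_mem _ 2) hsmem)
    have hmem : s + t * i ∈ F⟮i⟯ := add_mem hsmem (mul_mem htmem (mem_adjoin_simple_self F i))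
    exact mem_of_sq_eq_sq hsq hmem

theorem layer_eq_adjoin [Normal F Ω] [IsAlgClosed Ω] (h2 : (2 : Ω) ≠ 0)
    (hF : IsEuclideanField F) {i : Ω} (hi : i ^ 2 = -1) : ∀ n, layer F Ω (n + 2) = F⟮i⟯ := by
  intro n
  refine le_antisymm ?_ ((adjoin_simple_le_iff.2 (mem_layer_two_of_sq_mem h2 ?_)).trans
    (layer_mono (Nat.le_add_left 2 n)))
  · induction n with
    | zero =>
      exact layer_succ_le (n := 0) (M := (F⟮i⟯).toSubfield) h2
        (bot_le : (⊥ : IntermediateField F Ω) ≤ F⟮i⟯)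
        fun x _ hx2 _ ↦ mem_adjoin_of_sq_mem_bot hF hi hx2
    | succ n ih =>
      exact layer_succ_le (M := (F⟮i⟯).toSubfield) h2 ih
        fun x _ hx2 _ ↦ mem_adjoin_of_sq_mem_adjoin h2 hF hi (ih hx2)
  · exact sq_mem_bot_of_sq_eq_neg_one hi

theorem sqrtLayerThree_eq_adjoin [Normal F Ω] [IsAlgClosed Ω] (h2 : (2 : Ω) ≠ 0)
    (hF : IsEuclideanField F) {i : Ω} (hi : i ^ 2 = -1) : sqrtLayerThree F Ω = F⟮i⟯ := by
  have hib := notMem_bot_of_isEuclideanField hF hi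
  have hi2 := sq_mem_bot_of_sq_eq_neg_one (F := F) hi
  have hfin := finrank_adjoin_sqrt hib hi2
  refine le_antisymm (iSup₂_le fun L hL ↦ ?_) ?_
  · -- `F(√-1)` is the only quadratic extension of `F`, and it is quadratically closed
    obtain ⟨x, hx, hx2, hLx⟩ := exists_sqrt_generator h2 hL
    have hle : L ≤ F⟮i⟯ := hLx.trans_le (adjoin_simple_le_iff.2 (mem_adjoin_of_sq_mem_bot hF hi hx2))
    have : FiniteDimensional F F⟮i⟯ := Module.finite_of_finrank_eq_succ hfin
    obtain rfl : L = F⟮i⟯ := eq_of_le_of_finrank_eq hle (hL.trans hfin.symm)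
    intro y hy
    have hclosed : IsQuadraticallyClosed F⟮i⟯ Ω := isQuadraticallyClosed_iff.2 fun z hz ↦
      mem_bot_of_mem (mem_adjoin_of_sq_mem_adjoin h2 hF hi (mem_of_mem_bot hz))
    exact mem_of_mem_bot ((layer_eq_bot h2 hclosed 3).le hy)
  · intro y hy
    exact layer_three_le_sqrtLayerThree hfin (algebraMap_mem_layer (F := F⟮i⟯) 3 ⟨y, hy⟩)

/-! ### Elements of large order -/

theorem mem_layer_succ_of_div_or_mul [Normal F Ω] (h2 : (2 : Ω) ≠ 0) {n : ℕ} {x : Ω}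
    (hx2 : x ^ 2 ∈ layer F Ω (n + 1))
    (hσ : ∀ σ : Gal(Ω/F), σ x / x ∈ layer F Ω (n + 1) ∨ σ x * x ∈ layer F Ω (n + 1)) :
    x ∈ layer F Ω (n + 2) := by
  obtain rfl | hx := eq_or_ne x 0
  · exact zero_mem _
  refine mem_layer_succ h2 hx2 fun σ ↦ ?_
  rcases hσ σ with h | h
  · exact h
  · have : σ x / x = σ x * x / x ^ 2 := by field_simp
    rw [this]
    exact div_mem h hx2

/-- Outside the Euclidean case, if `√-1` is not in `F` and `F` has no quadratic extension except
`F(√-1)`, then `-1` is a sum of two squares. -/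
theorem exists_sq_add_sq_eq_neg_one [Normal F Ω] [IsAlgClosed Ω] (h2 : (2 : Ω) ≠ 0)
    (hF : ¬ IsEuclideanField F) {i : Ω} (hi : i ^ 2 = -1)
    (hib : i ∉ (⊥ : IntermediateField F Ω))
    (hsqrt : ∀ x : Ω, x ^ 2 ∈ (⊥ : IntermediateField F Ω) → x ∈ F⟮i⟯) :
    ∃ p q : F, p ^ 2 + q ^ 2 = -1 := by
  have hi2 := sq_mem_bot_of_sq_eq_neg_one (F := F) hi
  have hneg : ∀ y : F, y ^ 2 ≠ -1 := by
    intro y hy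
    refine hib ?_
    have hsq : i ^ 2 = algebraMap F Ω y ^ 2 := by
      rw [hi, ← map_pow, hy, map_neg, map_one]
    have hmem : algebraMap F Ω y ∈ (⊥ : IntermediateField F Ω) := IntermediateField.algebraMap_mem _ y
    exact mem_of_sq_eq_sq hsq hmem
  -- the square of `p + q i` lies in `F` only if `p q = 0`, so `a` or `-a` is a square
  have hor : ∀ a : F, a ≠ 0 → (∃ y : F, y ≠ 0 ∧ a = y ^ 2) ∨ ∃ y : F, y ≠ 0 ∧ -a = y ^ 2 := by
    intro a ha
    obtain ⟨x, hx⟩ := IsAlgClosed.exists_pow_nat_eq (algebraMap F Ω a) two_pos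
    obtain ⟨p, q, rfl⟩ := exists_eq_add_mul_of_finrank_eq_two (finrank_adjoin_sqrt hib hi2)
      (mem_adjoin_simple_self F i) hib (hsqrt x (mem_bot.2 ⟨a, hx.symm⟩))
    have hpq : p * q = 0 := by
      by_contra h
      refine hib (mem_bot.2 ⟨(a - p ^ 2 + q ^ 2) / (2 * (p * q)), ?_⟩)
      have h0 : algebraMap F Ω p * algebraMap F Ω q ≠ 0 := by
        rw [← map_mul]
        simpa using h
      simp only [map_div₀, map_add, map_sub, map_mul, map_pow, map_ofNat]
      rw [div_eq_iff (mul_ne_zero h2 h0), ← hx]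
      linear_combination algebraMap F Ω q ^ 2 * hi
    have hinj := (algebraMap F Ω).injective
    rcases mul_eq_zero.1 hpq with rfl | rfl
    · refine Or.inr ⟨q, ?_, hinj ?_⟩
      · rintro rfl
        exact ha (hinj (by simpa using hx.symm))
      · rw [map_neg, ← hx, map_zero, map_pow]
        linear_combination -algebraMap F Ω q ^ 2 * hi
    · refine Or.inl ⟨p, ?_, hinj ?_⟩
      · rintro rfl
        exact ha (hinj (by simpa using hx.symm))
      · rw [← hx, map_zero, map_pow]
        ring
  by_contra! hsum
  refine hF ⟨?_, ?_, ?_, hor⟩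
  · rintro ⟨y, hy, h⟩
    exact hy (pow_eq_zero_iff two_ne_zero |>.1 h.symm)
  · rintro _ ⟨y, hy, rfl⟩ _ ⟨z, hz, rfl⟩
    have h0 : y ^ 2 + z ^ 2 ≠ 0 := by
      intro h
      apply hneg (y / z)
      field_simp
      linear_combination h
    rcases hor _ h0 with h | ⟨w, hw, h⟩
    · exact h
    · refine absurd ?_ (hsum (y / w) (z / w))
      field_simp
      linear_combination -h
  · rintro _ ⟨y, hy, rfl⟩ _ ⟨z, hz, rfl⟩
    exact ⟨y * z, mul_ne_zero hy hz, by ring⟩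

/-- If `√a` is not in `F(√-1)` for some `a` in `F`, then some automorphism fixes `√-1` and negates
`√a`; it acts with order `8` on `a^(1/8)` and with order `16` on `a^(1/16)`. -/
theorem exists_large_order_of_notMem_adjoin [Normal F Ω] [IsAlgClosed Ω] (h2 : (2 : Ω) ≠ 0)
    {i x : Ω} (hi : i ^ 2 = -1) (hx2 : x ^ 2 ∈ (⊥ : IntermediateField F Ω)) (hx : x ∉ F⟮i⟯) :
    (∃ σ : Gal(Ω/F), ∃ t ∈ layer F Ω 5, (σ ^ 2 ^ 3) t ≠ t) ∧
      ∃ σ : Gal(Ω/F), ∃ z ∈ sqrtLayerThree F Ω, (σ ^ 2 ^ 2) z ≠ z := by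
  obtain ⟨d, hd⟩ := mem_bot.1 hx2
  have hx0 : x ≠ 0 := by
    rintro rfl
    exact hx (zero_mem _)
  have hxb : x ∉ (⊥ : IntermediateField F Ω) := fun h ↦ hx ((bot_le : ⊥ ≤ F⟮i⟯) h)
  obtain ⟨τ', hτ'⟩ := exists_algEquiv_eq_neg (K := F⟮i⟯) h2 (fun h ↦ hx (mem_of_mem_bot h))
    (mem_bot_of_mem ((bot_le : ⊥ ≤ F⟮i⟯) hx2))
  have hτ'i : τ' i = i := τ'.commutes (⟨i, mem_adjoin_simple_self F i⟩ : F⟮i⟯)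
  let τ : Gal(Ω/F) := τ'.restrictScalars F
  have hτx : τ x = -x := hτ'
  have hτi : τ i = i := hτ'i
  have hτi2 : (τ ^ 2) i = i := by rw [pow_two, AlgEquiv.mul_apply, hτi, hτi]
  have hτi4 : ((τ ^ 2) ^ 2) i = i := by rw [pow_two (τ ^ 2), AlgEquiv.mul_apply, hτi2, hτi2]
  obtain ⟨y, hy⟩ := IsAlgClosed.exists_pow_nat_eq x two_pos
  obtain ⟨z, hz⟩ := IsAlgClosed.exists_pow_nat_eq y two_pos
  obtain ⟨t, ht⟩ := IsAlgClosed.exists_pow_nat_eq z two_pos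
  have hy0 : y ≠ 0 := by
    rintro rfl
    exact hx0 (by simpa using hy.symm)
  have hz0 : z ≠ 0 := by
    rintro rfl
    exact hy0 (by simpa using hz.symm)
  have ht0 : t ≠ 0 := by
    rintro rfl
    exact hz0 (by simpa using ht.symm)
  have hτy := sq_apply_eq_neg hi hτi hτx hy
  have hτz := sq_apply_eq_neg hi hτi2 hτy hz
  have hτt := sq_apply_eq_neg hi hτi4 hτz ht
  have hne {w : Ω} (hw : w ≠ 0) : -w ≠ w := by
    intro h
    refine mul_ne_zero h2 hw ?_
    linear_combination -h
  have hy4 : y ^ 4 = algebraMap F Ω d := by rw [hd, ← hy]; ring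
  have hz8 : z ^ 8 = algebraMap F Ω d := by rw [← hy4, ← hz]; ring
  have ht16 : t ^ 16 = algebraMap F Ω d := by rw [← hz8, ← ht]; ring
  refine ⟨⟨τ, t, ?_, ?_⟩, τ, z, ?_, ?_⟩
  · have hxm : x ∈ layer F Ω 2 := mem_layer_two_of_sq_mem h2 hx2
    have hym : y ∈ layer F Ω 3 := mem_layer_succ h2 (hy ▸ hxm) fun σ ↦
      mem_layer_two_of_pow_four_eq_one h2
        (map_div_self_pow_eq_one hy0 (by rw [hy4, σ.commutes]))
    have hzm : z ∈ layer F Ω 4 := mem_layer_succ h2 (hz ▸ hym) fun σ ↦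
      layer_mono (by norm_num) (mem_layer_two_of_pow_eight_eq_one h2
        (map_div_self_pow_eq_one hz0 (by rw [hz8, σ.commutes])))
    exact mem_layer_succ h2 (ht ▸ hzm) fun σ ↦
      layer_mono (by norm_num) (mem_layer_three_of_pow_sixteen_eq_one h2
        (map_div_self_pow_eq_one ht0 (by rw [ht16, σ.commutes])))
  · rw [show τ ^ 2 ^ 3 = ((τ ^ 2) ^ 2) ^ 2 by rw [← pow_mul, ← pow_mul]; norm_num, hτt]
    exact hne ht0
  · refine layer_three_le_sqrtLayerThree (finrank_adjoin_sqrt hxb hx2) ?_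
    have hxL : x ∈ (⊥ : IntermediateField F⟮x⟯ Ω) := mem_bot_of_mem (mem_adjoin_simple_self F x)
    have hym : y ∈ layer F⟮x⟯ Ω 2 := mem_layer_two_of_sq_mem h2 (hy ▸ hxL)
    refine mem_layer_succ h2 (n := 1) (hz ▸ hym) fun σ ↦ mem_layer_two_of_pow_four_eq_one h2
      (map_div_self_pow_eq_one hz0 ?_)
    rw [show z ^ 4 = x by rw [← hy, ← hz]; ring]
    exact σ.commutes (⟨x, mem_adjoin_simple_self F x⟩ : F⟮x⟯)
  · rw [show τ ^ 2 ^ 2 = (τ ^ 2) ^ 2 by rw [← pow_mul]; norm_num, hτz]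
    exact hne hz0

/-- If `√-1` is not in `F` and `u = p + q√-1` has norm `-1`, then `F(√u)/F` is cyclic of degree four.
An automorphism negating `√-1` acts with order `4` on `√u`, with order `8` on `u^(1/4)` and with
order `16` on `u^(1/8)`. -/
theorem exists_large_order_of_sq_add_sq_eq_neg_one [Normal F Ω] [IsAlgClosed Ω] (h2 : (2 : Ω) ≠ 0)
    {i : Ω} (hi : i ^ 2 = -1) (hib : i ∉ (⊥ : IntermediateField F Ω)) {p q : F}
    (hpq : p ^ 2 + q ^ 2 = -1) :
    (∃ σ : Gal(Ω/F), ∃ t ∈ layer F Ω 5, (σ ^ 2 ^ 3) t ≠ t) ∧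
      ∃ σ : Gal(Ω/F), ∃ z ∈ sqrtLayerThree F Ω, (σ ^ 2 ^ 2) z ≠ z := by
  have hi2 := sq_mem_bot_of_sq_eq_neg_one (F := F) hi
  have hpq' : algebraMap F Ω p ^ 2 + algebraMap F Ω q ^ 2 = -1 := by
    simpa using congrArg (algebraMap F Ω) hpq
  obtain ⟨u, hu⟩ : ∃ u, u = algebraMap F Ω p + algebraMap F Ω q * i := ⟨_, rfl⟩
  have hui : u ∈ F⟮i⟯ := by
    rw [hu]
    exact add_mem (IntermediateField.algebraMap_mem _ p)
      (mul_mem (IntermediateField.algebraMap_mem _ q) (mem_adjoin_simple_self F i))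
  have hconj (σ : Gal(Ω/F)) (h : σ i = -i) : σ u * u = -1 := by
    rw [hu, map_add, map_mul, σ.commutes, σ.commutes, h]
    linear_combination hpq' - algebraMap F Ω q ^ 2 * hi
  have hor (σ : Gal(Ω/F)) : σ u = u ∨ σ u * u = -1 := by
    rcases eq_or_eq_neg_of_sq_mem_bot hi2 σ with h | h
    · left
      rw [hu, map_add, map_mul, σ.commutes, σ.commutes, h]
    · exact Or.inr (hconj σ h)
  obtain ⟨τ, hτi⟩ := exists_algEquiv_eq_neg h2 hib hi2
  have hτu := hconj τ hτi
  have hu0 : u ≠ 0 := by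
    intro h
    simp [h] at hτu
  obtain ⟨v, hv⟩ := IsAlgClosed.exists_pow_nat_eq u two_pos
  obtain ⟨w, hw⟩ := IsAlgClosed.exists_pow_nat_eq v two_pos
  obtain ⟨t, ht⟩ := IsAlgClosed.exists_pow_nat_eq w two_pos
  have hv0 : v ≠ 0 := by
    rintro rfl
    exact hu0 (by simpa using hv.symm)
  have hw0 : w ≠ 0 := by
    rintro rfl
    exact hv0 (by simpa using hw.symm)
  have ht0 : t ≠ 0 := by
    rintro rfl
    exact hw0 (by simpa using ht.symm)
  have hw4 : w ^ 4 = u := by rw [← hv, ← hw]; ring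
  have ht8 : t ^ 8 = u := by rw [← hw4, ← ht]; ring
  have hτi2 : (τ ^ 2) i = i := by rw [pow_two, AlgEquiv.mul_apply, hτi, map_neg, hτi, neg_neg]
  have hτi4 : ((τ ^ 2) ^ 2) i = i := by rw [pow_two (τ ^ 2), AlgEquiv.mul_apply, hτi2, hτi2]
  -- `τ v * v` is a square root of `-1`, hence negated by `τ`
  have hτv : (τ ^ 2) v = -v := by
    have hsq : (τ v * v) ^ 2 = i ^ 2 := by
      rw [mul_pow, ← map_pow, hv, hτu, hi]
    have hneg : τ (τ v * v) = -(τ v * v) := by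
      rcases sq_eq_sq_iff_eq_or_eq_neg.1 hsq with h | h <;> rw [h]
      · exact hτi
      · rw [map_neg, hτi]
    have hτv0 : τ v ≠ 0 := by simpa using hv0
    refine mul_right_cancel₀ hτv0 ?_
    rw [map_mul] at hneg
    rw [pow_two, AlgEquiv.mul_apply, hneg]
    ring
  have hτw := sq_apply_eq_neg hi hτi2 hτv hw
  have hτt := sq_apply_eq_neg hi hτi4 hτw ht
  have hne {s : Ω} (hs : s ≠ 0) : -s ≠ s := by
    intro h
    refine mul_ne_zero h2 hs ?_
    linear_combination -h
  have hfin := finrank_adjoin_sqrt hib hi2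
  refine ⟨⟨τ, t, ?_, ?_⟩, τ, w, ?_, ?_⟩
  · have hum : u ∈ layer F Ω 2 := le_layer_two_of_finrank_eq_two h2 hfin hui
    have hvm : v ∈ layer F Ω 3 := by
      refine mem_layer_succ_of_div_or_mul h2 (hv ▸ hum) fun σ ↦ (hor σ).imp (fun h ↦ ?_) fun h ↦ ?_
      · have := map_div_self_pow_eq_one (σ := σ) (m := 2) hv0 (by rw [hv, h])
        exact mem_layer_two_of_pow_four_eq_one h2 (by linear_combination ((σ v / v) ^ 2 + 1) * this)
      · refine mem_layer_two_of_pow_four_eq_one h2 ?_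
        rw [mul_pow, ← map_pow, show v ^ 4 = u ^ 2 by rw [← hv]; ring, map_pow, ← mul_pow, h]
        norm_num
    have hwm : w ∈ layer F Ω 4 := by
      refine mem_layer_succ_of_div_or_mul h2 (hw ▸ hvm) fun σ ↦ (hor σ).imp (fun h ↦ ?_) fun h ↦ ?_
      · exact layer_mono (by norm_num) (mem_layer_two_of_pow_four_eq_one h2
          (map_div_self_pow_eq_one (σ := σ) hw0 (by rw [hw4, h])))
      · refine layer_mono (by norm_num) (mem_layer_two_of_pow_eight_eq_one h2 ?_)
        rw [mul_pow, ← map_pow, show w ^ 8 = u ^ 2 by rw [← hw4]; ring, map_pow, ← mul_pow, h]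
        norm_num
    refine mem_layer_succ_of_div_or_mul h2 (ht ▸ hwm) fun σ ↦ (hor σ).imp (fun h ↦ ?_) fun h ↦ ?_
    · exact layer_mono (by norm_num) (mem_layer_two_of_pow_eight_eq_one h2
        (map_div_self_pow_eq_one (σ := σ) ht0 (by rw [ht8, h])))
    · refine layer_mono (by norm_num) (mem_layer_three_of_pow_sixteen_eq_one h2 ?_)
      rw [mul_pow, ← map_pow, show t ^ 16 = u ^ 2 by rw [← ht8]; ring, map_pow, ← mul_pow, h]
      norm_num
  · rw [show τ ^ 2 ^ 3 = ((τ ^ 2) ^ 2) ^ 2 by rw [← pow_mul, ← pow_mul]; norm_num, hτt]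
    exact hne ht0
  · refine layer_three_le_sqrtLayerThree hfin ?_
    have hvm : v ∈ layer F⟮i⟯ Ω 2 := mem_layer_two_of_sq_mem h2 (hv ▸ mem_bot_of_mem hui)
    refine mem_layer_succ h2 (n := 1) (hw ▸ hvm) fun σ ↦ mem_layer_two_of_pow_four_eq_one h2
      (map_div_self_pow_eq_one hw0 ?_)
    rw [hw4]
    exact σ.commutes (⟨u, hui⟩ : F⟮i⟯)
  · rw [show τ ^ 2 ^ 2 = (τ ^ 2) ^ 2 by rw [← pow_mul]; norm_num, hτw]
    exact hne hw0

theorem exists_large_order [Normal F Ω] [IsAlgClosed Ω] (h2 : (2 : Ω) ≠ 0)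
    (hq : ¬ IsQuadraticallyClosed F Ω) (hF : ¬ IsEuclideanField F) :
    (∃ σ : Gal(Ω/F), ∃ t ∈ layer F Ω 5, (σ ^ 2 ^ 3) t ≠ t) ∧
      ∃ σ : Gal(Ω/F), ∃ z ∈ sqrtLayerThree F Ω, (σ ^ 2 ^ 2) z ≠ z := by
  obtain ⟨i, hi⟩ := IsAlgClosed.exists_pow_nat_eq (-1 : Ω) two_pos
  by_cases hsqrt : ∀ x : Ω, x ^ 2 ∈ (⊥ : IntermediateField F Ω) → x ∈ F⟮i⟯
  · have hib : i ∉ (⊥ : IntermediateField F Ω) := fun h ↦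
      hq (isQuadraticallyClosed_iff.2 fun x hx ↦ adjoin_simple_le_iff.2 h (hsqrt x hx))
    obtain ⟨p, q, hpq⟩ := exists_sq_add_sq_eq_neg_one h2 hF hi hib hsqrt
    exact exists_large_order_of_sq_add_sq_eq_neg_one h2 hi hib hpq
  · push Not at hsqrt
    obtain ⟨x, hx2, hx⟩ := hsqrt
    exact exists_large_order_of_notMem_adjoin h2 hi hx2 hx

end QuadTower

open QuadTower in
theorem proposition2 (F Ω : Type*) [Field F] [Field Ω] [Algebra F Ω] [IsAlgClosure F Ω]
    (hchar : ringChar F ≠ 2) :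
    (QuadTower.IsQuadraticallyClosed F Ω →
      QuadTower.sqrtLayerThree F Ω = ⊥ ∧ ∀ n : ℕ, 1 ≤ n → QuadTower.layer F Ω n = ⊥) ∧
    (QuadTower.IsEuclideanField F →
      QuadTower.sqrtLayerThree F Ω = QuadTower.layer F Ω 2 ∧
        ∀ n : ℕ, 2 ≤ n → QuadTower.layer F Ω n = QuadTower.layer F Ω 2) ∧
    (¬ QuadTower.IsQuadraticallyClosed F Ω → ¬ QuadTower.IsEuclideanField F →
      IsGalois F (QuadTower.layer F Ω 5) ∧
      IsGalois F (QuadTower.sqrtLayerThree F Ω) ∧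
      QuadTower.sqrtLayerThree F Ω ≤ QuadTower.layer F Ω 5 ∧
      Monoid.exponent Gal(QuadTower.layer F Ω 5/F) = 16 ∧
      Monoid.exponent Gal(QuadTower.sqrtLayerThree F Ω/F) = 8 ∧
      QuadTower.sqrtLayerThree F Ω ≠ QuadTower.layer F Ω 5) := by
  have : IsAlgClosed Ω := IsAlgClosure.isAlgClosed F
  have : Normal F Ω := IsAlgClosure.normal F Ω
  have h2 : (2 : Ω) ≠ 0 := by
    rw [← map_ofNat (algebraMap F Ω) 2, map_ne_zero]
    exact Ring.two_ne_zero hchar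
  refine ⟨fun h ↦ ⟨sqrtLayerThree_eq_bot h2 h, fun n _ ↦ layer_eq_bot h2 h n⟩, fun h ↦ ?_,
    fun hq hF ↦ ?_⟩
  · obtain ⟨i, hi⟩ := IsAlgClosed.exists_pow_nat_eq (-1 : Ω) two_pos
    have hlayer := layer_eq_adjoin h2 h hi
    refine ⟨(sqrtLayerThree_eq_adjoin h2 h hi).trans (hlayer 0).symm, fun n hn ↦ ?_⟩
    obtain ⟨k, rfl⟩ := Nat.exists_eq_add_of_le' hn
    exact (hlayer k).trans (hlayer 0).symm
  · obtain ⟨h5, h3⟩ := exists_large_order h2 hq hF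
    have hG5 := isGalois_layer (F := F) h2 5
    have hG3 := isGalois_sqrtLayerThree (F := F) h2
    have he5 : Monoid.exponent Gal(layer F Ω 5/F) = 16 :=
      exponent_eq_two_pow (n := 3) hG5 (fun σ ↦ pow_two_pow_apply_eq_of_mem_layer h2 σ 4) h5
    have he3 : Monoid.exponent Gal(sqrtLayerThree F Ω/F) = 8 :=
      exponent_eq_two_pow (n := 2) hG3
        (fun σ _ ↦ pow_two_pow_three_apply_eq_of_mem_sqrtLayerThree h2 σ) h3
    refine ⟨hG5, hG3, sqrtLayerThree_le_layer_five h2, he5, he3, fun h ↦ ?_⟩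
    rw [h, he5] at he3
    norm_num at he3
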